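/- **Theorem 4.8.** Let $X$ be a complex Banach space, $L(X)$ the algebra of bounded linear operators on $X$, $K(X)$ the ideal of compact operators, and $\Pi : L(X)\to \mathcal C(X)=L(X)/K(X)$ the natural projection onto the Calkin algebra. Call an element $a$ of a unital ring *quasinilpotent* if $1-xa$ is invertible for every $x$ commuting with $a$. For $T\in L(X)$, an idempotent $P\in L(X)$ is *associated to $T$ in $\mathcal C(X)$* if $\Pi(P)$ commutes with $\Pi(T)$, $\Pi(P)\Pi(T)$ is quasinilpotent, and $\Pi(T)$ is left $\Pi(P)$-invertible, i.e. $\Pi(T)+\Pi(P)$ has a left inverse in $\mathcal C(X)$ that commutes with $\Pi(P)$. The operator $T$ is *left pseudo semi-B-Fredholm* if such an idempotent exists. For a fixed idempotent $P$ and $V\in L(X)$ write $X_1=R(P)$, $X_2=N(P)=R(I-P)$, $V_1=(PVP)|_{X_1}\in L(X_1)$ and $V_2=((I-P)V(I-P))|_{X_2}\in L(X_2)$. An operator $V$ is *Riesz* if $V-\lambda I$ is Fredholm for every $\lambda\in\mathbb C\setminus\{0\}$. Let $\alpha(V)=\dim N(V)$ and $\beta(V)=\operatorname{codim} R(V)$,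 with values in $\mathbb N\cup\{\infty\}$. Let $T\in L(X)$ be left pseudo semi-B-Fredholm and let $P\in L(X)$ be an idempotent associated to $T$ in $\mathcal C(X)$. Then there exists $\varepsilon>0$ such that for every $U\in L(X)$ satisfying 1. $\Pi(P)$ commutes with $\Pi(U)$, 2. $U_1$ is a Riesz operator and the commutator $[T_1,U_1]=T_1U_1-U_1T_1$ is compact, 3. $\|U_2\|<\varepsilon$, the operator $T+U$ is left pseudo semi-B-Fredholm, $\alpha(T_2+U_2)\le\alpha(T_2)$, and if $\beta(T_2)=\infty$ then $\beta(T_2+U_2)=\infty$. -/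

import Mathlib

noncomputable section

namespace PseudoBFredholm

/-! ### Invertibility notions in a unital ring -/

section RingNotions

variable {A : Type*} [Ring A]

/-- `a` is quasinilpotent: `1 - x a` is invertible for every `x` commuting with `a`. -/
def IsQuasinilpotent (a : A) : Prop :=
  ∀ x : A, Commute x a → IsUnit (1 - x * a)

/-- `a` is left `p`-invertible: `a p = p a`, and `a + p` is left invertible in the commutant
`C_p = {x | x p = p x}` of `p`. -/
def IsLeftPInvertible (p a : A) : Prop :=
  Commute a p ∧ ∃ b : A, Commute b p ∧ b * (a + p) = 1

end RingNotions

/-! ### The Calkin algebra -/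

section Calkin

variable (X : Type*) [NormedAddCommGroup X] [NormedSpace ℂ X]

/-- `K(X)`, the ideal of compact operators in `L(X)`. -/
def compactIdeal : Ideal (X →L[ℂ] X) where
  carrier := {T | IsCompactOperator T}
  add_mem' := fun ha hb => IsCompactOperator.add ha hb
  zero_mem' := isCompactOperator_zero
  smul_mem' := fun S _ hT => IsCompactOperator.clm_comp hT S

instance compactIdeal_isTwoSided : (compactIdeal X).IsTwoSided :=
  ⟨fun S hT => IsCompactOperator.comp_clm hT S⟩

/-- The Calkin algebra `C(X) = L(X) / K(X)`. -/
abbrev Calkin : Type _ := (X →L[ℂ] X) ⧸ compactIdeal X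

/-- The natural projection `Π : L(X) → C(X)`. -/
def toCalkin : (X →L[ℂ] X) →+* Calkin X := Ideal.Quotient.mk (compactIdeal X)

end Calkin

/-! ### Operators -/

section Operators

variable {X : Type*} [NormedAddCommGroup X] [NormedSpace ℂ X]

/-- `P` is associated to `T` in the Calkin algebra: `P` is an idempotent operator, `Π(P)` commutes
with `Π(T)`, `Π(P) Π(T)` is quasinilpotent and `Π(T)` is left `Π(P)`-invertible. -/
structure IsLeftAssociated (P T : X →L[ℂ] X) : Prop where
  idempotent : IsIdempotentElem P
  commute : Commute (toCalkin X P) (toCalkin X T)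
  quasinilpotent : IsQuasinilpotent (toCalkin X P * toCalkin X T)
  leftInvertible : IsLeftPInvertible (toCalkin X P) (toCalkin X T)

/-- `T` is left pseudo semi-B-Fredholm: `Π(T)` is left generalized Drazin invertible in the Calkin
algebra. -/
def IsLeftPseudoSemiBFredholm (T : X →L[ℂ] X) : Prop :=
  ∃ P : X →L[ℂ] X, IsLeftAssociated P T

/-- The compression `(P T P)|_{R(P)}`, as a bounded operator on the range `R(P)`. For an idempotent
`P`, the operator `T₁` is `compression P T` on `X₁ = R(P)`, and `T₂` is `compression (1 - P) T` on
`X₂ = R(I - P) = N(P)`. -/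
def compression (P T : X →L[ℂ] X) : P.range →L[ℂ] P.range :=
  ((P * T * P).comp P.range.subtypeL).codRestrict P.range
    (fun x => ⟨T (P x), rfl⟩)

/-- `T` is a Riesz operator: `T - z I` is Fredholm for every nonzero complex number `z`.
On a Banach space the extra conditions in Mathlib's `IsFredholm` (strictness, complemented null space)
follow from closed range, finite nullity and finite defect. -/
def IsRiesz (T : X →L[ℂ] X) : Prop :=
  ∀ z : ℂ, z ≠ 0 → (T - z • (1 : X →L[ℂ] X)).IsFredholm

/-- The nullity `α(T)`, the dimension of the null space of `T`, in `ℕ ∪ {∞}`. -/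
def nullity (T : X →L[ℂ] X) : ℕ∞ :=
  Cardinal.toENat (Module.rank ℂ T.ker)

/-- The defect `β(T)`, the codimension of the range of `T`, in `ℕ ∪ {∞}`. -/
def defect (T : X →L[ℂ] X) : ℕ∞ :=
  Cardinal.toENat (Module.rank ℂ (X ⧸ T.range))

end Operators

end PseudoBFredholm

end

/-! The same idempotent `P` serves `T + U`. Write `p, t, u` for the classes in the Calkin algebra;
`p` commutes with `t` and `u`, so the two corners can be treated separately.

On the `p` corner, `p t` is quasinilpotent and `p u` has spectrum in `{0}`, because Fredholm
operators are invertible modulo compacts. They commute since `[T₁, U₁]` is compact, so their sum is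
quasinilpotent (`isQuasinilpotent_add`). On the `1 - p` corner a left inverse survives a small
perturbation by a Neumann series; `isLeftPInvertible_add` glues the corners.

For nullity and defect, `T₂` has a left inverse `B` modulo compacts. Hence `T₂` is bounded below on
a complement of its kernel, and a small perturbation stays injective there. Moreover `T₂` has finite
defect iff `B` has finite nullity, and perturbing `T₂` only multiplies `B` on the left by an
invertible operator. -/

noncomputable section

namespace PseudoBFredholm

/-! ### Quasinilpotent elements of a Banach algebra -/

section BanachAlgebra

variable {A : Type*} [NormedRing A]

/-- If the spectrum of `a` is contained in `{0}`, the powers of `a` decay faster than any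
geometric sequence. -/
theorem exists_norm_pow_le_of_isUnit_sub [NormedAlgebra ℂ A] [CompleteSpace A] {a : A}
    (ha : ∀ z : ℂ, z ≠ 0 → IsUnit (a - z • 1))
    {ε : ℝ} (hε : 0 < ε) : ∃ C > 0, ∀ n : ℕ, ‖a ^ n‖ ≤ C * ε ^ n := by
  have hr : spectralRadius ℂ a = 0 := by
    simp only [spectralRadius, ENNReal.iSup_eq_zero]
    intro z hz
    by_contra h
    have hz0 : z ≠ 0 := by simpa using h
    refine (spectrum.mem_iff.1 hz) ?_
    rw [← IsUnit.neg_iff, neg_sub, Algebra.algebraMap_eq_smul_one]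
    exact ha z hz0
  have ht := spectrum.pow_norm_pow_one_div_tendsto_nhds_spectralRadius a
  rw [hr] at ht
  have hev := ht.eventually (gt_mem_nhds (ENNReal.ofReal_pos.2 hε))
  have hO : (fun n : ℕ => a ^ n) =O[Filter.atTop] fun n : ℕ => ε ^ n := by
    refine Asymptotics.IsBigO.of_bound 1 ?_
    filter_upwards [hev, Filter.eventually_ge_atTop 1] with n hn h1
    rw [ENNReal.ofReal_lt_ofReal_iff hε, one_div] at hn
    have hpow := pow_le_pow_left₀ (by positivity) hn.le n
    rw [Real.rpow_inv_natCast_pow (norm_nonneg _) (by omega)] at hpow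
    rw [one_mul, Real.norm_of_nonneg (by positivity)]
    exact hpow
  obtain ⟨C, hC, h⟩ := Asymptotics.bound_of_isBigO_nat_atTop hO
  refine ⟨C, hC, fun n => ?_⟩
  have := h (x := n) (pow_ne_zero n hε.ne')
  rwa [Real.norm_of_nonneg (by positivity)] at this

/-- `1 - a` is a factor of the unit `1 - a ^ n`, with commuting cofactor the geometric sum. -/
theorem isUnit_one_sub_of_norm_pow_lt_one [CompleteSpace A] {a : A} {n : ℕ} (h : ‖a ^ n‖ < 1) :
    IsUnit (1 - a) := by
  have hu : IsUnit (1 - a ^ n) := isUnit_one_sub_of_norm_lt_one h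
  rw [← mul_neg_geom_sum] at hu
  refine (Commute.isUnit_mul_iff ?_).1 hu |>.1
  exact (Commute.sum_right _ _ _ fun i _ =>
    ((Commute.one_left _).sub_left ((Commute.refl a).pow_right i)))

theorem IsQuasinilpotent.isUnit_sub [NormedAlgebra ℂ A] {a : A}
    (ha : IsQuasinilpotent a) (z : ℂ) (hz : z ≠ 0) :
    IsUnit (a - z • 1) := by
  have h := ha (z⁻¹ • 1) ((Commute.one_left a).smul_left _)
  have h' : a - z • 1 = (-z) • (1 - (z⁻¹ • (1 : A)) * a) := by
    rw [smul_sub, smul_mul_assoc, one_mul, smul_smul, neg_mul, mul_inv_cancel₀ hz]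
    simp [sub_eq_add_neg, add_comm]
  rw [h']
  exact h.smul (Units.mk0 (-z) (neg_ne_zero.2 hz))

/-- The sum of two commuting elements of a complex Banach algebra whose spectra are contained in
`{0}` is quasinilpotent. -/
theorem isQuasinilpotent_add [NormedAlgebra ℂ A] [CompleteSpace A] {a b : A}
    (ha : ∀ z : ℂ, z ≠ 0 → IsUnit (a - z • 1))
    (hb : ∀ z : ℂ, z ≠ 0 → IsUnit (b - z • 1)) (hab : Commute a b) :
    IsQuasinilpotent (a + b) := by
  intro x hx
  -- The binomial expansion doubles `ε`; this choice gives `‖x‖ * (2 * ε) ≤ 1 / 2`.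
  set ε : ℝ := (4 * (‖x‖ + 1))⁻¹ with hε
  have hx0 : 0 ≤ ‖x‖ := norm_nonneg x
  have hε0 : 0 < ε := by positivity
  obtain ⟨C, hC, hCa⟩ := exists_norm_pow_le_of_isUnit_sub ha hε0
  obtain ⟨D, hD, hDb⟩ := exists_norm_pow_le_of_isUnit_sub hb hε0
  have hsum : ∀ n : ℕ, ‖(a + b) ^ n‖ ≤ C * D * (2 * ε) ^ n := by
    intro n
    rw [hab.add_pow']
    refine (norm_sum_le _ _).trans ?_
    have : C * D * (2 * ε) ^ n
        = ∑ m ∈ Finset.HasAntidiagonal.antidiagonal n,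
            n.choose m.1 • (C * ε ^ m.1 * (D * ε ^ m.2)) := by
      rw [two_mul, (Commute.all ε ε).add_pow', Finset.mul_sum]
      refine Finset.sum_congr rfl fun m _ => ?_
      simp only [nsmul_eq_mul]
      ring
    rw [this]
    refine Finset.sum_le_sum fun m _ => (norm_nsmul_le).trans ?_
    rw [nsmul_eq_mul]
    refine mul_le_mul_of_nonneg_left ((norm_mul_le (a ^ m.1) (b ^ m.2)).trans ?_) (by positivity)
    exact mul_le_mul (hCa _) (hDb _) (norm_nonneg _) (by positivity)
  obtain ⟨n, hn⟩ := exists_pow_lt_of_lt_one (x := (C * D)⁻¹) (y := (1 / 2 : ℝ)) (by positivity)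
    (by norm_num)
  -- A positive exponent is needed: `‖x ^ 0‖ ≤ 1` may fail, as `‖1‖ = 1` is not assumed.
  refine isUnit_one_sub_of_norm_pow_lt_one (n := n + 1) ?_
  rw [hx.mul_pow]
  have hxe : ‖x‖ * (2 * ε) ≤ 1 / 2 := by
    rw [hε, mul_inv]
    have : ‖x‖ * (‖x‖ + 1)⁻¹ ≤ 1 := by
      rw [← div_eq_mul_inv, div_le_one (by positivity)]
      linarith
    linarith
  calc ‖x ^ (n + 1) * (a + b) ^ (n + 1)‖
      ≤ ‖x‖ ^ (n + 1) * (C * D * (2 * ε) ^ (n + 1)) :=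
        (norm_mul_le _ _).trans (mul_le_mul (norm_pow_le' _ n.succ_pos) (hsum _) (norm_nonneg _)
          (by positivity))
    _ = C * D * (‖x‖ * (2 * ε)) ^ (n + 1) := by rw [mul_pow]; ring
    _ ≤ C * D * (1 / 2) ^ (n + 1) := by gcongr
    _ ≤ C * D * (1 / 2) ^ n := by
        gcongr C * D * ?_
        exact pow_le_pow_of_le_one (by norm_num) (by norm_num) n.le_succ
    _ < 1 := by rwa [mul_comm, ← lt_inv_mul_iff₀' (by positivity), mul_one]

end BanachAlgebra

/-! ### The Calkin algebra as a Banach algebra -/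

section Calkin

variable {X : Type*} [NormedAddCommGroup X] [NormedSpace ℂ X]

theorem toCalkin_smul (z : ℂ) (T : X →L[ℂ] X) : toCalkin X (z • T) = z • toCalkin X T := rfl

theorem toCalkin_eq_toCalkin_iff {S T : X →L[ℂ] X} :
    toCalkin X S = toCalkin X T ↔ IsCompactOperator (S - T) :=
  Ideal.Quotient.eq

end Calkin

section CalkinNorm

variable (X : Type*) [NormedAddCommGroup X] [NormedSpace ℂ X] [CompleteSpace X]

instance isClosed_compactIdeal : IsClosed (compactIdeal X : Set (X →L[ℂ] X)) :=
  isClosed_setOfPred_isCompactOperator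

/-- The quotient norm makes the Calkin algebra a normed ring. -/
instance calkinNormedRing : NormedRing (Calkin X) where
  __ := (inferInstance : Ring (Calkin X))
  __ := Submodule.Quotient.normedAddCommGroup (compactIdeal X)
  norm_mul_le x y := by
    refine le_of_forall_pos_le_add fun ε hε => ?_
    have hc : ContinuousAt (fun δ : ℝ => (‖x‖ + δ) * (‖y‖ + δ)) 0 := by fun_prop
    have h0 : (‖x‖ + 0) * (‖y‖ + 0) < ‖x‖ * ‖y‖ + ε := by simpa using hε
    obtain ⟨δ, hδ, hδ0⟩ :=
      (((hc.eventually (gt_mem_nhds h0)).filter_mono nhdsWithin_le_nhds).and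
        (self_mem_nhdsWithin : Set.Ioi (0 : ℝ) ∈ nhdsWithin 0 (Set.Ioi 0))).exists
    obtain ⟨S, rfl, hS⟩ := Submodule.Quotient.norm_mk_lt x hδ0
    obtain ⟨T, rfl, hT⟩ := Submodule.Quotient.norm_mk_lt y hδ0
    refine le_trans (Submodule.Quotient.norm_mk_le (compactIdeal X) (S * T)) ?_
    refine (norm_mul_le _ _).trans (le_trans ?_ hδ.le)
    exact mul_le_mul hS.le hT.le (norm_nonneg _) (by have := hδ0.le; positivity)

instance calkinNormedAlgebra : NormedAlgebra ℂ (Calkin X) where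
  __ := (inferInstance : Algebra ℂ (Calkin X))
  norm_smul_le := (Submodule.Quotient.normedSpace (compactIdeal X) ℂ).norm_smul_le

instance calkinCompleteSpace : CompleteSpace (Calkin X) :=
  Submodule.Quotient.completeSpace (compactIdeal X)

end CalkinNorm

/-! ### Operators left invertible modulo compacts -/

section CompactPerturbation

variable {Y : Type*} [NormedAddCommGroup Y] [NormedSpace ℂ Y]

/-- `K` is the identity on this kernel, so the identity there is compact. -/
theorem finiteDimensional_ker_one_sub_of_isCompactOperator {K : Y →L[ℂ] Y}
    (hK : IsCompactOperator K) : FiniteDimensional ℂ (1 - K : Y →L[ℂ] Y).ker := by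
  have hx : ∀ x ∈ (1 - K : Y →L[ℂ] Y).ker, K x = x := fun x hx =>
    (sub_eq_zero.1 (by simpa using hx)).symm
  have hr := IsCompactOperator.restrict (f := K.toLinearMap) hK
    (V := (1 - K : Y →L[ℂ] Y).ker) (fun x h => by simp [hx x h])
    (1 - K : Y →L[ℂ] Y).isClosed_ker
  refine FiniteDimensional.of_isCompactOperator_id (𝕜 := ℂ) ?_
  convert! hr using 1
  ext x
  exact (hx x x.2).symm

theorem finiteDimensional_ker_of_mul_eq_one_sub {A B K : Y →L[ℂ] Y}
    (hK : IsCompactOperator K) (h : B * A = 1 - K) : FiniteDimensional ℂ A.ker := by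
  have := finiteDimensional_ker_one_sub_of_isCompactOperator hK
  refine Submodule.finiteDimensional_of_le (S₂ := (1 - K : Y →L[ℂ] Y).ker) fun x hx => ?_
  have hx' : A x = 0 := hx
  change (1 - K : Y →L[ℂ] Y) x = 0
  rw [← h, mul_apply_eq_comp, hx', map_zero]

/-- An operator with a left inverse modulo compact operators is bounded below on the kernel of any
operator whose kernel meets its own kernel trivially. -/
theorem exists_norm_le_mul_norm_of_mul_eq_one_sub {Z : Type*} [NormedAddCommGroup Z]
    [NormedSpace ℂ Z] {A B K : Y →L[ℂ] Y} (hK : IsCompactOperator K) (h : B * A = 1 - K)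
    (f : Y →L[ℂ] Z) (hf : ∀ x, A x = 0 → f x = 0 → x = 0) :
    ∃ C > 0, ∀ x, f x = 0 → ‖x‖ ≤ C * ‖A x‖ := by
  by_contra! hcon
  have hex : ∀ n : ℕ, ∃ x, f x = 0 ∧ ‖x‖ = 1 ∧ ‖A x‖ ≤ 1 / ((n : ℝ) + 1) := by
    intro n
    obtain ⟨x, hfx, hx⟩ := hcon (n + 1) (by positivity)
    have hx0 : 0 < ‖x‖ := lt_of_le_of_lt (by positivity) hx
    refine ⟨((‖x‖⁻¹ : ℝ) : ℂ) • x, by simp [hfx], ?_, ?_⟩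
    · simp [norm_smul, hx0.ne']
    · rw [map_smul, norm_smul, Complex.norm_real, norm_inv, norm_norm, le_div_iff₀ (by positivity),
        mul_assoc, inv_mul_le_iff₀ hx0, mul_one, mul_comm]
      exact hx.le
  choose x hfx hx hAx using hex
  have hA : Filter.Tendsto (fun n => A (x n)) Filter.atTop (nhds 0) :=
    squeeze_zero_norm hAx tendsto_one_div_add_atTop_nhds_zero_nat
  obtain ⟨S, hS, hKS⟩ := hK.image_closedBall_subset_compact 1
  obtain ⟨y, -, φ, hφ, hy⟩ := hS.tendsto_subseq (x := fun n => K (x n))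
    fun n => hKS ⟨x n, by simp [hx], rfl⟩
  have hAφ := hA.comp hφ.tendsto_atTop
  have hxy : Filter.Tendsto (fun n => x (φ n)) Filter.atTop (nhds y) := by
    -- Since `A x → 0`, compactness of `K` alone makes the unit vectors converge.
    have h1 : ∀ n, x (φ n) = B (A (x (φ n))) + K (x (φ n)) := fun n => by
      rw [← mul_apply_eq_comp, h]
      simp
    have h2 := ((B.continuous.tendsto 0).comp hAφ).add hy
    simp only [map_zero, zero_add] at h2
    exact h2.congr fun n => (h1 n).symm
  have hy1 : ‖y‖ = 1 :=
    tendsto_nhds_unique ((continuous_norm.tendsto y).comp hxy) (by simp [Function.comp_def, hx])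
  have hAy : A y = 0 := tendsto_nhds_unique ((A.continuous.tendsto y).comp hxy) hAφ
  have hfy : f y = 0 :=
    tendsto_nhds_unique ((f.continuous.tendsto y).comp hxy) (by simp [Function.comp_def, hfx])
  simp [hf y hAy hfy] at hy1

/-- The nullity of an operator with a left inverse modulo compact operators does not increase under
small perturbations. -/
theorem exists_nullity_add_le {A B K : Y →L[ℂ] Y} (hK : IsCompactOperator K)
    (h : B * A = 1 - K) :
    ∃ ε > 0, ∀ V : Y →L[ℂ] Y, ‖V‖ < ε → nullity (A + V) ≤ nullity A := by
  have := finiteDimensional_ker_of_mul_eq_one_sub hK h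
  obtain ⟨f, hf⟩ := Submodule.ClosedComplemented.of_finiteDimensional A.ker
  obtain ⟨C, hC, hbound⟩ := exists_norm_le_mul_norm_of_mul_eq_one_sub hK h f
    fun x hx hfx => by
      have := hf ⟨x, hx⟩
      rw [hfx] at this
      exact (congrArg Subtype.val this).symm
  refine ⟨C⁻¹, by positivity, fun V hV => ?_⟩
  refine Cardinal.toENat.monotone' (LinearMap.rank_le_of_injective
    (f.toLinearMap.domRestrict (A + V).ker) ?_)
  rw [← LinearMap.ker_eq_bot, LinearMap.ker_eq_bot']
  rintro ⟨x, hx⟩ hfx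
  have hfx' : f x = 0 := hfx
  have hAV : A x = -V x := eq_neg_of_add_eq_zero_left hx
  have h1 := hbound x hfx'
  rw [hAV, norm_neg] at h1
  have h2 : C * ‖V x‖ ≤ C * ‖V‖ * ‖x‖ := by
    rw [mul_assoc]
    exact mul_le_mul_of_nonneg_left (V.le_opNorm x) hC.le
  have h3 : C * ‖V‖ < 1 := by
    rwa [← lt_inv_mul_iff₀ hC, mul_one]
  have h4 : ‖x‖ = 0 := by nlinarith [norm_nonneg x]
  exact Subtype.ext (norm_eq_zero.1 h4)

/-- For a compact operator `K` on a Banach space, the range of `1 - K` has finite codimension. -/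
theorem finite_quotient_range_one_sub_of_isCompactOperator [CompleteSpace Y] {K : Y →L[ℂ] Y}
    (hK : IsCompactOperator K) : Module.Finite ℂ (Y ⧸ (1 - K : Y →L[ℂ] Y).range) := by
  by_contra hinf
  set D : Y →L[ℂ] Y := 1 - K with hD
  have : FiniteDimensional ℂ D.ker := finiteDimensional_ker_one_sub_of_isCompactOperator hK
  obtain ⟨f, hf⟩ := Submodule.ClosedComplemented.of_finiteDimensional D.ker
  obtain ⟨W, hW⟩ := Submodule.exists_isCompl D.range
  have hWinf : ¬ Module.Finite ℂ W := fun _ =>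
    hinf (Module.Finite.equiv (Submodule.quotientEquivOfIsCompl _ _ hW).symm)
  have hrank : (Module.finrank ℂ D.ker : Cardinal) ≤ Module.rank ℂ W := by
    refine Cardinal.natCast_le_aleph0.trans ?_
    rw [← not_lt, Module.rank_lt_aleph0_iff]
    exact hWinf
  -- Infinite codimension leaves room to embed `D.ker` in `W`. Then `D + R`, with `R` of finite
  -- rank, is injective, hence invertible by the Fredholm alternative; surjectivity forces `j` onto
  -- `W`, a contradiction.
  obtain ⟨g, hg⟩ := Module.le_rank_iff_exists_linearMap.1 hrank
  let j : D.ker →ₗ[ℂ] W := g ∘ₗ (Module.finBasis ℂ D.ker).equivFun.toLinearMap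
  have hj : Function.Injective j := hg.comp (LinearEquiv.injective _)
  let R : Y →L[ℂ] Y := (LinearMap.toContinuousLinearMap (W.subtype ∘ₗ j)).comp f
  have hR : ∀ x, R x = j (f x) := fun _ => rfl
  have hdisj : ∀ x, D x + R x = 0 → D x = 0 ∧ j (f x) = 0 := by
    intro x hx
    have h0 : D x = 0 := by
      refine Submodule.disjoint_def.1 hW.disjoint (D x) ⟨x, rfl⟩ ?_
      rw [eq_neg_of_add_eq_zero_left hx, hR]
      exact W.neg_mem (j (f x)).2
    refine ⟨h0, ?_⟩
    rw [h0, zero_add, hR] at hx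
    exact Subtype.ext hx
  have hRc : IsCompactOperator R :=
    haveI : ProperSpace D.ker := FiniteDimensional.proper ℂ _
    (isCompactOperator_of_locallyCompactSpace_dom f).clm_comp
      (LinearMap.toContinuousLinearMap (W.subtype ∘ₗ j))
  have hKR : IsCompactOperator (K - R : Y →L[ℂ] Y) := hK.sub hRc
  have hunit : IsUnit (D + R) := by
    rcases hKR.hasEigenvalue_or_mem_resolventSet (one_ne_zero (α := ℂ)) with he | hr
    · obtain ⟨x, hx⟩ := he.exists_hasEigenvector
      have hx1 : K x - R x = x := by simpa using hx.apply_eq_smul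
      have hx2 : D x + R x = 0 := by
        rw [hD]
        simp only [sub_apply, one_apply_eq_self]
        nth_rw 1 [← hx1]
        abel
      obtain ⟨h0, h1⟩ := hdisj x hx2
      have h2 : f x = 0 := hj (by rw [h1, map_zero])
      have h3 := hf ⟨x, h0⟩
      rw [h2] at h3
      exact absurd (congrArg Subtype.val h3).symm hx.2
    · rw [spectrum.mem_resolventSet_iff, map_one] at hr
      convert hr using 1
      rw [hD]
      abel
  have hsurj := (ContinuousLinearMap.isUnit_iff_bijective.1 hunit).2
  refine hWinf (Module.Finite.of_surjective j fun w => ?_)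
  obtain ⟨x, hx⟩ := hsurj w
  refine ⟨f x, Subtype.ext ?_⟩
  have h0 : D x = 0 := by
    refine Submodule.disjoint_def.1 hW.disjoint (D x) ⟨x, rfl⟩ ?_
    have : D x = (w : Y) - j (f x) := by rw [← hx, ← hR]; simp
    rw [this]
    exact W.sub_mem w.2 (j (f x)).2
  rw [← hR, ← hx]
  simp [h0]

/-- If `B` is a left inverse of `A` modulo compact operators and `A` has finite defect, then `B`
has finite nullity. -/
theorem finite_ker_of_finite_quotient_range {A B K : Y →L[ℂ] Y} (hK : IsCompactOperator K)
    (h : B * A = 1 - K) (hA : Module.Finite ℂ (Y ⧸ A.range)) : FiniteDimensional ℂ B.ker := by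
  have := finiteDimensional_ker_one_sub_of_isCompactOperator hK
  have hmap : FiniteDimensional ℂ ((1 - K : Y →L[ℂ] Y).ker.map A.toLinearMap) := inferInstance
  -- The kernel of `q` is `B.ker ∩ A.range`, which lies in the image under `A` of the kernel of `1 -
  -- K`.
  let q : B.ker →ₗ[ℂ] Y ⧸ A.range := A.range.mkQ.domRestrict B.ker
  have hq : FiniteDimensional ℂ (LinearMap.ker q) := by
    have : FiniteDimensional ℂ ((LinearMap.ker q).map B.ker.subtype) := by
      refine Submodule.finiteDimensional_of_le (S₂ := (1 - K : Y →L[ℂ] Y).ker.map A.toLinearMap) ?_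
      rintro _ ⟨⟨y, hy⟩, hqy, rfl⟩
      obtain ⟨x, rfl⟩ : y ∈ A.range := (Submodule.Quotient.mk_eq_zero _).1 hqy
      refine ⟨x, ?_, rfl⟩
      change (1 - K : Y →L[ℂ] Y) x = 0
      rw [← h]
      exact hy
    exact Module.Finite.equiv
      (Submodule.equivMapOfInjective _ B.ker.injective_subtype (LinearMap.ker q)).symm
  have hrange : FiniteDimensional ℂ (LinearMap.range q) := inferInstance
  have : FiniteDimensional ℂ (B.ker ⧸ LinearMap.ker q) :=
    Module.Finite.equiv q.quotKerEquivRange.symm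
  exact Module.Finite.of_submodule_quotient (LinearMap.ker q)

/-- If `B` is a left inverse of `A` modulo compact operators and `B` has finite nullity, then `A`
has finite defect. -/
theorem finite_quotient_range_of_finite_ker [CompleteSpace Y] {A B K : Y →L[ℂ] Y}
    (hK : IsCompactOperator K) (h : B * A = 1 - K) (hB : FiniteDimensional ℂ B.ker) :
    Module.Finite ℂ (Y ⧸ A.range) := by
  have := finite_quotient_range_one_sub_of_isCompactOperator hK
  let q : Y ⧸ A.range →ₗ[ℂ] Y ⧸ (1 - K : Y →L[ℂ] Y).range :=
    Submodule.mapQ _ _ B.toLinearMap (by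
      rintro _ ⟨x, rfl⟩
      exact ⟨x, by rw [← h]; rfl⟩)
  have hq : FiniteDimensional ℂ (LinearMap.ker q) := by
    have hle : LinearMap.ker q ≤ B.ker.map A.range.mkQ := by
      intro z hz
      obtain ⟨y, rfl⟩ := Submodule.Quotient.mk_surjective _ z
      obtain ⟨x, hx⟩ : B y ∈ (1 - K : Y →L[ℂ] Y).range := (Submodule.Quotient.mk_eq_zero _).1 hz
      rw [← h] at hx
      have hx' : B (A x) = B y := hx
      refine ⟨y - A x, by simp [hx'], ?_⟩
      refine (Submodule.Quotient.eq _).2 ⟨-x, ?_⟩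
      simp
    exact Submodule.finiteDimensional_of_le hle
  have : FiniteDimensional ℂ ((Y ⧸ A.range) ⧸ LinearMap.ker q) :=
    Module.Finite.equiv q.quotKerEquivRange.symm
  exact Module.Finite.of_submodule_quotient (LinearMap.ker q)

theorem defect_eq_top_iff {A : Y →L[ℂ] Y} : defect A = ⊤ ↔ ¬ Module.Finite ℂ (Y ⧸ A.range) := by
  rw [defect, Cardinal.toENat_eq_top, ← not_lt, Module.rank_lt_aleph0_iff]

/-- An infinite defect of an operator with a left inverse modulo compact operators stays infinite
under small perturbations. -/
theorem exists_defect_add_eq_top [CompleteSpace Y] {A B K : Y →L[ℂ] Y}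
    (hK : IsCompactOperator K) (h : B * A = 1 - K) :
    ∃ ε > 0, ∀ V : Y →L[ℂ] Y, ‖V‖ < ε → defect A = ⊤ → defect (A + V) = ⊤ := by
  refine ⟨(‖B‖ + 1)⁻¹, by positivity, fun V hV => ?_⟩
  rw [defect_eq_top_iff, defect_eq_top_iff, not_imp_not]
  intro hfin
  have hBV : ‖-(B * V)‖ < 1 := by
    rw [norm_neg]
    rw [← one_div, lt_div_iff₀ (by positivity)] at hV
    nlinarith [norm_mul_le B V, norm_nonneg V, norm_nonneg B]
  -- `G = 1 + B V`, so `G⁻¹ B` is a left inverse of `A + V` modulo compacts whose kernel contains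
  -- `B.ker`.
  obtain ⟨G, hG⟩ := isUnit_one_sub_of_norm_lt_one hBV
  have hGK : IsCompactOperator ((↑G⁻¹ : Y →L[ℂ] Y) * K) := hK.clm_comp (↑G⁻¹ : Y →L[ℂ] Y)
  have hAV : ((↑G⁻¹ : Y →L[ℂ] Y) * B) * (A + V) = 1 - ↑G⁻¹ * K := by
    have : B * (A + V) = G - K := by rw [mul_add, h, hG]; abel
    rw [mul_assoc, this, mul_sub, Units.inv_mul]
  have hker := finite_ker_of_finite_quotient_range hGK hAV hfin
  refine finite_quotient_range_of_finite_ker hK h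
    (Submodule.finiteDimensional_of_le (S₂ := ((↑G⁻¹ : Y →L[ℂ] Y) * B).ker) fun x hx => ?_)
  have hx' : B x = 0 := hx
  change (↑G⁻¹ : Y →L[ℂ] Y) (B x) = 0
  rw [hx', map_zero]

end CompactPerturbation

/-! ### Invertibility in a corner ring -/

section Corner

/-- If `v - z p` is invertible in the corner ring `p A p`, then `v - z` is invertible in `A`. -/
theorem isUnit_sub_smul_one_of_corner {A : Type*} [Ring A] [Algebra ℂ A] {p v r : A} {z : ℂ}
    (hz : z ≠ 0) (hp : p * p = p) (hpv : p * v = v) (hvp : v * p = v) (hpr : p * r = r)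
    (hrp : r * p = r) (hl : r * (v - z • p) = p) (hr : (v - z • p) * r = p) :
    IsUnit (v - z • 1) := by
  have hsplit : v - z • (1 : A) = (v - z • p) - z • (1 - p) := by rw [smul_sub]; abel
  refine ⟨⟨v - z • 1, r - z⁻¹ • (1 - p), ?_, ?_⟩, rfl⟩
  · rw [hsplit, sub_mul, mul_sub, hr, mul_sub]
    simp [sub_mul, mul_sub, hp, hpr, hvp, inv_smul_smul₀ hz]
  · rw [hsplit, mul_sub, sub_mul, hl, sub_mul]
    simp [sub_mul, mul_sub, hp, hrp, hpv, smul_inv_smul₀ hz]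

end Corner

/-! ### Passing between operators on `R(P)` and on `X` -/

section RangeOfIdempotent

variable {X : Type*} [NormedAddCommGroup X] [NormedSpace ℂ X]

/-- `P` as an operator onto its range. -/
def rangeCorestrict (P : X →L[ℂ] X) : X →L[ℂ] P.range :=
  P.codRestrict P.range fun x => ⟨x, rfl⟩

/-- The operator on `X` that acts as `V` after applying `P`. -/
def extend (P : X →L[ℂ] X) (V : P.range →L[ℂ] P.range) : X →L[ℂ] X :=
  (P.range.subtypeL.comp V).comp (rangeCorestrict P)

variable {P : X →L[ℂ] X}

theorem extend_apply (V : P.range →L[ℂ] P.range) (x : X) :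
    extend P V x = V (rangeCorestrict P x) := rfl

theorem extend_one : extend P 1 = P := rfl

theorem extend_sub (V W : P.range →L[ℂ] P.range) :
    extend P (V - W) = extend P V - extend P W := rfl

theorem extend_smul (z : ℂ) (V : P.range →L[ℂ] P.range) :
    extend P (z • V) = z • extend P V := by
  ext x
  simp [extend_apply]

theorem apply_of_mem_range (hP : IsIdempotentElem P) (x : P.range) : P x = x := by
  obtain ⟨_, y, rfl⟩ := x
  exact congrArg (fun S : X →L[ℂ] X => S y) hP.eq

theorem rangeCorestrict_coe (hP : IsIdempotentElem P) (x : P.range) : rangeCorestrict P x = x :=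
  Subtype.ext (apply_of_mem_range hP x)

theorem extend_mul (hP : IsIdempotentElem P) (V W : P.range →L[ℂ] P.range) :
    extend P (V * W) = extend P V * extend P W := by
  ext x
  simp [extend_apply, rangeCorestrict_coe hP]

theorem extend_compression (hP : IsIdempotentElem P) (T : X →L[ℂ] X) :
    extend P (compression P T) = P * T * P := by
  ext x
  exact congrArg (fun y => P (T y)) (congrArg (fun S : X →L[ℂ] X => S x) hP.eq)

theorem isCompactOperator_extend {V : P.range →L[ℂ] P.range} (hV : IsCompactOperator V) :
    IsCompactOperator (extend P V) :=
  (hV.clm_comp P.range.subtypeL).comp_clm (rangeCorestrict P)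

theorem isClosed_range_of_isIdempotentElem (hP : IsIdempotentElem P) :
    IsClosed (P.range : Set X) := by
  have : (P.range : Set X) = {x | P x = x} := by
    ext x
    exact ⟨fun hx => apply_of_mem_range hP ⟨x, hx⟩, fun hx => ⟨x, hx⟩⟩
  rw [this]
  exact isClosed_eq P.continuous continuous_id

theorem isCompactOperator_of_isCompactOperator_extend (hP : IsIdempotentElem P)
    {V : P.range →L[ℂ] P.range} (hV : IsCompactOperator (extend P V)) : IsCompactOperator V := by
  have h := (hV.comp_clm P.range.subtypeL).codRestrict
    (fun x => (V (rangeCorestrict P x)).2) (isClosed_range_of_isIdempotentElem hP)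
  convert! h using 1
  ext x
  simp [extend_apply, rangeCorestrict_coe hP]

/-- Lets identities modulo compacts on `R(P)` be proved in the Calkin algebra of `X`, and
conversely. -/
theorem toCalkin_extend_eq_iff (hP : IsIdempotentElem P) {V W : P.range →L[ℂ] P.range} :
    toCalkin X (extend P V) = toCalkin X (extend P W) ↔ IsCompactOperator (V - W) := by
  rw [toCalkin_eq_toCalkin_iff, ← extend_sub]
  exact ⟨isCompactOperator_of_isCompactOperator_extend hP, isCompactOperator_extend⟩

theorem isCompactOperator_of_finiteDimensional_range {Y : Type*} [NormedAddCommGroup Y]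
    [NormedSpace ℂ Y] {S : Y →L[ℂ] Y} (hS : FiniteDimensional ℂ S.range) :
    IsCompactOperator S := by
  have : ProperSpace S.range := FiniteDimensional.proper ℂ _
  exact (isCompactOperator_of_locallyCompactSpace_dom
    (S.codRestrict S.range fun x => ⟨x, rfl⟩)).clm_comp S.range.subtypeL

/-- A Fredholm operator is invertible modulo compact operators. -/
theorem exists_isCompactOperator_of_isFredholm {Y : Type*} [NormedAddCommGroup Y]
    [NormedSpace ℂ Y] {S : Y →L[ℂ] Y} (hS : S.IsFredholm) :
    ∃ R : Y →L[ℂ] Y, IsCompactOperator (R * S - 1 : Y →L[ℂ] Y) ∧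
      IsCompactOperator (S * R - 1 : Y →L[ℂ] Y) := by
  obtain ⟨R, hl, hr⟩ := hS.exists_isQuasiInverse
  refine ⟨R, isCompactOperator_of_finiteDimensional_range ?_,
    isCompactOperator_of_finiteDimensional_range ?_⟩
  · exact Module.Finite.iff_fg.2 (LinearMap.hasFiniteRange_iff_range.1
      (LinearMap.FiniteRangeSetoid.equiv_iff_hasFiniteRange.1 hl))
  · exact Module.Finite.iff_fg.2 (LinearMap.hasFiniteRange_iff_range.1
      (LinearMap.FiniteRangeSetoid.equiv_iff_hasFiniteRange.1 hr))

/-- The class of a Riesz operator on the range of an idempotent has spectrum contained in `{0}` in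
the Calkin algebra. -/
theorem IsRiesz.isUnit_toCalkin_extend_sub (hP : IsIdempotentElem P)
    {V : P.range →L[ℂ] P.range} (hV : IsRiesz V) (z : ℂ) (hz : z ≠ 0) :
    IsUnit (toCalkin X (extend P V) - z • 1) := by
  obtain ⟨R, hl, hr⟩ := exists_isCompactOperator_of_isFredholm (hV z hz)
  rw [← toCalkin_extend_eq_iff hP, extend_mul hP, extend_sub, extend_smul, extend_one, map_mul,
    map_sub, toCalkin_smul] at hl hr
  have hPV : toCalkin X P * toCalkin X (extend P V) = toCalkin X (extend P V) := by
    simpa only [extend_mul hP, extend_one, map_mul] using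
      congrArg (fun W => toCalkin X (extend P W)) (one_mul V)
  have hVP : toCalkin X (extend P V) * toCalkin X P = toCalkin X (extend P V) := by
    simpa only [extend_mul hP, extend_one, map_mul] using
      congrArg (fun W => toCalkin X (extend P W)) (mul_one V)
  have hPR : toCalkin X P * toCalkin X (extend P R) = toCalkin X (extend P R) := by
    simpa only [extend_mul hP, extend_one, map_mul] using
      congrArg (fun W => toCalkin X (extend P W)) (one_mul R)
  have hRP : toCalkin X (extend P R) * toCalkin X P = toCalkin X (extend P R) := by
    simpa only [extend_mul hP, extend_one, map_mul] using
      congrArg (fun W => toCalkin X (extend P W)) (mul_one R)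
  have hPP : toCalkin X P * toCalkin X P = toCalkin X P := by rw [← map_mul, hP.eq]
  exact isUnit_sub_smul_one_of_corner hz hPP hPV hVP hPR hRP hl hr

end RangeOfIdempotent

/-! ### Gluing left inverses across the corners -/

section LeftInvertible

variable {A : Type*} [Ring A]

/-- Left `p`-invertibility of `t` passes to `t + u` when `1 + p (t + u)` and `1 + b (1 - p) u` are
units. -/
theorem isLeftPInvertible_add {p t u b : A} (hp : IsIdempotentElem p) (ht : Commute t p)
    (hu : Commute u p) (hb : Commute b p) (hbt : b * (t + p) = 1)
    (h₁ : IsUnit (1 + p * (t + u))) (h₂ : IsUnit (1 + b * ((1 - p) * u))) :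
    IsLeftPInvertible p (t + u) := by
  obtain ⟨g, hg⟩ := h₁
  obtain ⟨k, hk⟩ := h₂
  have hpp : Commute p p := Commute.refl p
  have hq : Commute (1 - p) p := (Commute.one_left p).sub_left hpp
  have hgp : Commute (g : A) p := by
    rw [hg]
    exact (Commute.one_left p).add_left (hpp.mul_left (ht.add_left hu))
  have hkp : Commute (k : A) p := by
    rw [hk]
    exact (Commute.one_left p).add_left (hb.mul_left (hq.mul_left hu))
  -- Blockwise inverse: on the `p` corner `t + u + p` acts as `g`; on the other, `b` reduces it to
  -- `k`.
  refine ⟨ht.add_left hu, ↑g⁻¹ * p + ↑k⁻¹ * ((1 - p) * b),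
    (hgp.units_inv_left.mul_left hpp).add_left
      (hkp.units_inv_left.mul_left (hq.mul_left hb)), ?_⟩
  have hp' : p * p = p := hp
  have e₁ : p * (t + u + p) = g * p := by
    rw [hg, mul_add, hp', add_mul, one_mul, mul_assoc, (ht.add_left hu).eq, ← mul_assoc, hp',
      add_comm]
  have hqq : (1 - p) * p = 0 := by rw [sub_mul, one_mul, hp', sub_self]
  have e₂ : (1 - p) * b * (t + u + p) = k * (1 - p) := by
    have h3 : t + u + p = (t + p) + u := by abel
    have hbq : (1 - p) * b = b * (1 - p) := by rw [sub_mul, mul_sub, hb.eq, one_mul, mul_one]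
    have huq : (1 - p) * u = u * (1 - p) := by rw [sub_mul, mul_sub, hu.eq, one_mul, mul_one]
    have hqq' : (1 - p) * (1 - p) = 1 - p := by rw [mul_sub, hqq, sub_zero, mul_one]
    rw [h3, mul_add, mul_assoc, hbt, mul_one, hk, add_mul, one_mul, hbq, huq]
    rw [mul_assoc b (u * (1 - p)), mul_assoc u, hqq', ← huq, mul_assoc]
  rw [add_mul, mul_assoc, e₁, mul_assoc, e₂, ← mul_assoc, ← mul_assoc, Units.inv_mul,
    Units.inv_mul, one_mul, one_mul]
  abel

end LeftInvertible

/-! ### Perturbing the associated idempotent -/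

section Perturbation

variable {X : Type*} [NormedAddCommGroup X] [NormedSpace ℂ X]

theorem extend_compression_of_commute {P T : X →L[ℂ] X} (hP : IsIdempotentElem P)
    (h : Commute (toCalkin X P) (toCalkin X T)) :
    toCalkin X (extend P (compression P T)) = toCalkin X P * toCalkin X T := by
  rw [extend_compression hP, map_mul, map_mul, mul_assoc, ← h.eq, ← mul_assoc, ← map_mul, hP.eq]

/-- If `P` is associated to `T`, then the compression of `T` to the range of `1 - P` has a left
inverse modulo compact operators. -/
theorem IsLeftAssociated.exists_mul_compression_eq {P T : X →L[ℂ] X} (h : IsLeftAssociated P T) :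
    ∃ B K : (1 - P : X →L[ℂ] X).range →L[ℂ] (1 - P : X →L[ℂ] X).range, IsCompactOperator K ∧
      B * compression (1 - P) T = 1 - K := by
  obtain ⟨b, hb, hbt⟩ := h.leftInvertible.2
  obtain ⟨S, rfl⟩ := Ideal.Quotient.mk_surjective b
  change Commute (toCalkin X S) (toCalkin X P) at hb
  change toCalkin X S * _ = 1 at hbt
  have hQ : IsIdempotentElem (1 - P) := h.idempotent.one_sub
  have hS : Commute (toCalkin X (1 - P)) (toCalkin X S) := by
    rw [map_sub, map_one]
    exact (Commute.one_left _).sub_left hb.symm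
  have hT : Commute (toCalkin X (1 - P)) (toCalkin X T) := by
    rw [map_sub, map_one]
    exact (Commute.one_left _).sub_left h.commute
  have hPQ : toCalkin X P * toCalkin X (1 - P) = 0 := by
    rw [← map_mul, h.idempotent.mul_one_sub_self, map_zero]
  have hQQ : toCalkin X (1 - P) * toCalkin X (1 - P) = toCalkin X (1 - P) := by
    rw [← map_mul, hQ.eq]
  refine ⟨compression (1 - P) S,
    1 - compression (1 - P) S * compression (1 - P) T, ?_, by abel⟩
  refine (toCalkin_extend_eq_iff hQ).1 ?_
  rw [extend_one, extend_mul hQ, map_mul, extend_compression_of_commute hQ hS,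
    extend_compression_of_commute hQ hT, hS.eq, mul_assoc, ← mul_assoc (toCalkin X (1 - P)), hQQ,
    hT.eq, ← mul_assoc]
  calc toCalkin X (1 - P) = toCalkin X S * (toCalkin X T + toCalkin X P) * toCalkin X (1 - P) := by
        rw [hbt, one_mul]
    _ = _ := by rw [mul_assoc, add_mul, hPQ, add_zero, mul_assoc]

variable [CompleteSpace X]

/-- The idempotent associated to `T` is associated to every perturbation `T + U` by an operator `U`
whose compression to `R(P)` is a Riesz operator essentially commuting with that of `T` and whose
compression to `N(P)` is small. -/
theorem IsLeftAssociated.exists_isLeftAssociated_add {P T : X →L[ℂ] X} (h : IsLeftAssociated P T) :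
    ∃ ε > 0, ∀ U : X →L[ℂ] X, Commute (toCalkin X P) (toCalkin X U) →
      IsRiesz (compression P U) →
      IsCompactOperator
        (compression P T * compression P U - compression P U * compression P T) →
      ‖compression (1 - P) U‖ < ε → IsLeftAssociated P (T + U) := by
  obtain ⟨b, hb, hbt⟩ := h.leftInvertible.2
  obtain ⟨S, rfl⟩ := Ideal.Quotient.mk_surjective b
  change Commute (toCalkin X S) (toCalkin X P) at hb
  change toCalkin X S * _ = 1 at hbt
  have hP := h.idempotent
  have hQ : IsIdempotentElem (1 - P) := hP.one_sub
  set J := (1 - P : X →L[ℂ] X).range.subtypeL with hJ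
  set N : ℝ := ‖S‖ * ‖J‖ * ‖rangeCorestrict (1 - P)‖ with hN
  have hN0 : 0 ≤ N := by positivity
  refine ⟨(N + 1)⁻¹, by positivity, fun U hPU hR hK hU => ?_⟩
  have hcomm : Commute (toCalkin X P) (toCalkin X (T + U)) := by
    rw [map_add]
    exact h.commute.add_right hPU
  have hqn : IsQuasinilpotent (toCalkin X P * toCalkin X (T + U)) := by
    rw [map_add, mul_add, ← extend_compression_of_commute hP hPU]
    refine isQuasinilpotent_add h.quasinilpotent.isUnit_sub
      (hR.isUnit_toCalkin_extend_sub hP) ?_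
    rw [← extend_compression_of_commute hP h.commute]
    change _ * _ = _ * _
    rw [← map_mul, ← map_mul, ← extend_mul hP, ← extend_mul hP]
    exact (toCalkin_extend_eq_iff hP).2 hK
  refine ⟨hP, hcomm, hqn, ?_⟩
  rw [map_add] at hqn hcomm ⊢
  refine isLeftPInvertible_add (b := toCalkin X S) (by
    change _ * _ = _
    rw [← map_mul, hP.eq]) h.commute.symm hPU.symm hb hbt ?_ ?_
  · simpa using hqn (-1) ((Commute.one_left _).neg_left)
  · have hqU : Commute (toCalkin X (1 - P)) (toCalkin X U) := by
      rw [map_sub, map_one]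
      exact (Commute.one_left _).sub_left hPU
    -- The Neumann series is run in `L(X)` and the unit is then mapped to the Calkin algebra; `N`
    -- bounds the cost of extending from `N(P)` and multiplying by `S`.
    have hlt : ‖-(S * extend (1 - P) (compression (1 - P) U))‖ < 1 := by
      rw [norm_neg]
      have h1 : ‖S * extend (1 - P) (compression (1 - P) U)‖ ≤
          N * ‖compression (1 - P) U‖ := by
        calc _ ≤ ‖S‖ * ‖extend (1 - P) (compression (1 - P) U)‖ := norm_mul_le _ _
          _ ≤ ‖S‖ * (‖J‖ * ‖compression (1 - P) U‖ * ‖rangeCorestrict (1 - P)‖) := by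
            gcongr
            refine (ContinuousLinearMap.opNorm_comp_le _ _).trans ?_
            gcongr
            exact ContinuousLinearMap.opNorm_comp_le _ _
          _ = _ := by rw [hN]; ring
      rw [← one_div, lt_div_iff₀ (by positivity)] at hU
      nlinarith [norm_nonneg (compression (1 - P) U)]
    have hunit := (isUnit_one_sub_of_norm_lt_one hlt).map (toCalkin X)
    rwa [sub_neg_eq_add, map_add, map_one, map_mul, extend_compression_of_commute hQ hqU, map_sub,
      map_one] at hunit

end Perturbation

end PseudoBFredholm

end

theorem theorem4p8 {X : Type*} [NormedAddCommGroup X] [NormedSpace ℂ X] [CompleteSpace X]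
    (T P : X →L[ℂ] X) (hP : PseudoBFredholm.IsLeftAssociated P T) :
    ∃ ε : ℝ, 0 < ε ∧ ∀ U : X →L[ℂ] X,
      Commute (PseudoBFredholm.toCalkin X P) (PseudoBFredholm.toCalkin X U) →
      PseudoBFredholm.IsRiesz (PseudoBFredholm.compression P U) →
      IsCompactOperator
        (PseudoBFredholm.compression P T * PseudoBFredholm.compression P U -
          PseudoBFredholm.compression P U * PseudoBFredholm.compression P T) →
      ‖PseudoBFredholm.compression (1 - P) U‖ < ε →
      PseudoBFredholm.IsLeftPseudoSemiBFredholm (T + U) ∧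
      PseudoBFredholm.nullity
          (PseudoBFredholm.compression (1 - P) T + PseudoBFredholm.compression (1 - P) U) ≤
        PseudoBFredholm.nullity (PseudoBFredholm.compression (1 - P) T) ∧
      (PseudoBFredholm.defect (PseudoBFredholm.compression (1 - P) T) = ⊤ →
        PseudoBFredholm.defect
          (PseudoBFredholm.compression (1 - P) T + PseudoBFredholm.compression (1 - P) U) = ⊤) := by
  -- The defect argument uses the Fredholm alternative on `N(P)`, hence completeness.
  have : CompleteSpace (1 - P : X →L[ℂ] X).range :=
    (PseudoBFredholm.isClosed_range_of_isIdempotentElem hP.idempotent.one_sub).completeSpace_coe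
  obtain ⟨B, K, hK, hB⟩ := hP.exists_mul_compression_eq
  obtain ⟨ε₁, hε₁, h₁⟩ := hP.exists_isLeftAssociated_add
  obtain ⟨ε₂, hε₂, h₂⟩ := PseudoBFredholm.exists_nullity_add_le hK hB
  obtain ⟨ε₃, hε₃, h₃⟩ := PseudoBFredholm.exists_defect_add_eq_top hK hB
  refine ⟨min ε₁ (min ε₂ ε₃), lt_min hε₁ (lt_min hε₂ hε₃), fun U hPU hR hC hU => ?_⟩
  rw [lt_min_iff, lt_min_iff] at hU
  exact ⟨⟨P, h₁ U hPU hR hC hU.1⟩, h₂ _ hU.2.1, h₃ _ hU.2.2⟩
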